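/- Let $S$ be a nonempty finite set of positive integers, let $n=\max S$ and $[n]=\{1,\dots,n\}$. The Schubert matroid $\mathrm{SM}_n(S)$ is the matroid on the ground set $[n]$ whose bases are the sets $T\subseteq[n]$ with $|T|=|S|$ such that, for $1\le i\le |S|$, the $i$-th smallest element of $T$ does not exceed the $i$-th smallest element of $S$. Its matroid polytope $\mathcal P(\mathrm{SM}_n(S))\subset\mathbb R^n$ is the convex hull of the indicator vectors of its bases, and for a positive integer $t$ let $i(\mathrm{SM}_n(S),t)=|t\,\mathcal P(\mathrm{SM}_n(S))\cap\mathbb Z^n|$, where $t\,\mathcal P=\{t\alpha:\alpha\in\mathcal P\}$. Write the indicator vector of $S$ in $\{0,1\}^n$ as $(0^{r_1},1^{r_2},\dots,0^{r_{2m-1}},1^{r_{2m}})$ ($r_1$ zeros, followed by $r_2$ ones, and so on), where $r_1\ge 0$ and $r_i>0$ for $2\le i\le 2m$, and put $r(S)=(r_1,\dots,r_{2m})$. For $1\le i\le m$ let $$u_i=\min\Big\{r_{2i-1},\ \sum_{j=i+1}^{m}r_{2j}\Big\},\qquad v_i=\min\Big\{r_{2i},\ \sum_{j=1}^{i-1}r_{2j-1}\Big\},$$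 where empty sums are $0$. For integers $a,b,t\ge 0$ and $c\in\mathbb Z$ let $$F(a,b,c,t)=\sum_{j=0}^{a+b}(-1)^j\binom{a+b}{j}\binom{(t+1)(b-j)+a+c-1}{a+b-1},$$ where $\binom{0}{0}=1$ and, for integers $p,k$, $\binom{p}{k}=0$ if $k<0$ or $p<k$. **Theorem.** For every positive integer $t$, $$i(\mathrm{SM}_n(S),t)=\sum_{(c_1,\dots,c_m)}\ \prod_{j=1}^{m}F(r_{2j-1},r_{2j},c_j,t),$$ where the sum is over all integer vectors $(c_1,\dots,c_m)$ with $c_1+\cdots+c_m=0$ and, for every $1\le j\le m$, $-t\,v_j\le c_j\le t\,u_j$ and $c_1+\cdots+c_j\ge 0$. -/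

import Mathlib

namespace SchubertEhrhart

/-- `T ≤ S` for subsets of `[n]` (here `Fin n`, with its order): the two sets have the same
cardinality and the `i`-th smallest element of `T` does not exceed that of `S`, for every `i`. -/
def SubsetLE {n : ℕ} (T S : Finset (Fin n)) : Prop :=
  ∃ h : T.card = S.card, ∀ i : Fin S.card, T.orderEmbOfFin h i ≤ S.orderEmbOfFin rfl i

theorem card_filter_orderEmb {n k : ℕ} (T : Finset (Fin n)) (h : T.card = k)
    (p : Fin n → Prop) [DecidablePred p] :
    (T.filter p).card = (Finset.univ.filter fun i : Fin k => p (T.orderEmbOfFin h i)).card := by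
  have hT : T = Finset.univ.map (T.orderEmbOfFin h).toEmbedding := by simp
  conv_lhs => rw [hT, Finset.filter_map, Finset.card_map]
  rfl

theorem subsetLE_iff {n : ℕ} (T S : Finset (Fin n)) :
    SubsetLE T S ↔ T.card = S.card ∧
      ∀ k : Fin n, (S.filter (· < k)).card ≤ (T.filter (· < k)).card := by
  constructor
  · rintro ⟨h, hle⟩
    refine ⟨h, fun k => ?_⟩
    rw [card_filter_orderEmb T h, card_filter_orderEmb S rfl]
    apply Finset.card_le_card
    intro i hi
    simp only [Finset.mem_filter, Finset.mem_univ, true_and] at hi ⊢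
    exact lt_of_le_of_lt (hle i) hi
  · rintro ⟨h, hle⟩
    refine ⟨h, fun i => ?_⟩
    by_contra hlt
    rw [not_le] at hlt
    have h1 := hle (T.orderEmbOfFin h i)
    rw [card_filter_orderEmb T h, card_filter_orderEmb S rfl] at h1
    have h2 : (Finset.univ.filter fun j : Fin S.card =>
        T.orderEmbOfFin h j < T.orderEmbOfFin h i) = Finset.Iio i := by
      ext j; simp
    have h3 : Finset.Iic i ⊆ (Finset.univ.filter fun j : Fin S.card =>
        S.orderEmbOfFin rfl j < T.orderEmbOfFin h i) := by
      intro j hj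
      simp only [Finset.mem_filter, Finset.mem_univ, true_and]
      exact lt_of_le_of_lt ((S.orderEmbOfFin rfl).monotone (Finset.mem_Iic.1 hj)) hlt
    have h4 := Finset.card_le_card h3
    rw [h2] at h1
    simp only [Fin.card_Iio, Fin.card_Iic] at h1 h4
    omega

theorem subsetLE_exchange {n : ℕ} (S : Finset (Fin n)) :
    Matroid.ExchangeProperty (fun B : Set (Fin n) => ∃ T : Finset (Fin n), ↑T = B ∧ SubsetLE T S) := by
  rintro _ _ ⟨T, rfl, hT⟩ ⟨T', rfl, hT'⟩ e he
  rw [subsetLE_iff] at hT hT'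
  have he1 : e ∈ T := by simpa using he.1
  have he2 : e ∉ T' := by simpa using he.2
  have hne : (T' \ T).Nonempty := by
    rw [Finset.sdiff_nonempty]
    intro hsub
    have := Finset.eq_of_subset_of_card_le hsub (by omega)
    exact he2 (this ▸ he1)
  obtain ⟨f, hf, hmin⟩ := Finset.exists_min_image (T' \ T) id hne
  rw [Finset.mem_sdiff] at hf
  have hfe : f ∉ T.erase e := fun hc => hf.2 (Finset.mem_of_mem_erase hc)
  refine ⟨f, by simpa using hf, insert f (T.erase e), by simp, ?_⟩
  rw [subsetLE_iff]
  refine ⟨?_, fun k => ?_⟩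
  · rw [Finset.card_insert_of_notMem hfe, Finset.card_erase_of_mem he1]
    have := Finset.card_pos.2 ⟨e, he1⟩
    omega
  · by_cases hk : k ≤ f
    · refine (hT'.2 k).trans (Finset.card_le_card ?_)
      intro x hx
      simp only [Finset.mem_filter, Finset.mem_insert, Finset.mem_erase] at hx ⊢
      refine ⟨Or.inr ⟨fun hxe => he2 (hxe ▸ hx.1), ?_⟩, hx.2⟩
      by_contra hxT
      have := hmin x (Finset.mem_sdiff.2 ⟨hx.1, hxT⟩)
      exact absurd (lt_of_lt_of_le hx.2 hk) (not_lt.2 this)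
    · rw [not_le] at hk
      refine (hT.2 k).trans ?_
      rw [Finset.filter_insert, if_pos hk, Finset.filter_erase,
        Finset.card_insert_of_notMem (fun hc => hf.2 (Finset.mem_filter.1
          (Finset.mem_of_mem_erase hc)).1)]
      have := Finset.pred_card_le_card_erase (s := T.filter (· < k)) (a := e)
      omega

/-- The Schubert matroid `SM_n(S)`: ground set `[n]`, bases the sets `T ⊆ [n]` with `T ≤ S`. -/
def schubertMatroid {n : ℕ} (S : Finset (Fin n)) : Matroid (Fin n) :=
  Matroid.ofIsBaseOfFinite (E := Set.univ) Set.finite_univ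
    (fun B => ∃ T : Finset (Fin n), ↑T = B ∧ SubsetLE T S)
    ⟨↑S, S, rfl, rfl, fun _ => le_rfl⟩
    (subsetLE_exchange S)
    (fun _ _ => Set.subset_univ _)

/-- The matroid polytope: the convex hull in `ℝ^n` of the indicator vectors `e_B` of the bases. -/
def matroidPolytope {n : ℕ} (M : Matroid (Fin n)) : Set (Fin n → ℝ) :=
  convexHull ℝ {x | ∃ B, M.IsBase B ∧ x = B.indicator 1}

open scoped Pointwise in
/-- `i(P, t) = |tP ∩ ℤ^n|`, the number of lattice points in the dilation `tP = {tα : α ∈ P}`. -/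
noncomputable def latticePointCount {n : ℕ} (P : Set (Fin n → ℝ)) (t : ℕ) : ℕ :=
  {z : Fin n → ℤ | (fun i => (z i : ℝ)) ∈ (t : ℝ) • P}.ncard

/-- `r(S) = r` for `r = (r_1, …, r_{2m})`: `r_i > 0` for `i ≥ 2`, `r_1 + ⋯ + r_{2m} = n`, and the
indicator vector of `S` is `(0^{r_1}, 1^{r_2}, …, 0^{r_{2m-1}}, 1^{r_{2m}})`. The Lean index `i` of
`r` is one less than the index in `r_1, …, r_{2m}`, so the runs of ones are those with `i` odd;
the run with index `i` occupies the positions `k` (also counted from `0`) with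
`∑_{i' < i} r i' ≤ k < ∑_{i' ≤ i} r i'`. -/
structure IsRunEncoding {n m : ℕ} (S : Finset (Fin n)) (r : Fin (2 * m) → ℕ) : Prop where
  pos : ∀ i : Fin (2 * m), 0 < i.val → 0 < r i
  total : ∑ i, r i = n
  indicator : ∀ (i : Fin (2 * m)) (k : Fin n),
    ∑ i' ∈ Finset.Iio i, r i' ≤ k.val → k.val < ∑ i' ∈ Finset.Iic i, r i' →
      (k ∈ S ↔ Odd i.val)

/-- `r_{2j-1}`, the length of the `j`-th run of zeros (`j = 1, …, m` is `0, …, m - 1` in Lean). -/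
def zeroRun {m : ℕ} (r : Fin (2 * m) → ℕ) (j : Fin m) : ℕ := r ⟨2 * j.val, by omega⟩

/-- `r_{2j}`, the length of the `j`-th run of ones. -/
def oneRun {m : ℕ} (r : Fin (2 * m) → ℕ) (j : Fin m) : ℕ := r ⟨2 * j.val + 1, by omega⟩

/-- `u_i = min {r_{2i-1}, ∑_{j > i} r_{2j}}`. -/
def upper {m : ℕ} (r : Fin (2 * m) → ℕ) (i : Fin m) : ℕ :=
  min (zeroRun r i) (∑ j ∈ Finset.Ioi i, oneRun r j)

/-- `v_i = min {r_{2i}, ∑_{j < i} r_{2j-1}}`. -/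
def lower {m : ℕ} (r : Fin (2 * m) → ℕ) (i : Fin m) : ℕ :=
  min (oneRun r i) (∑ j ∈ Finset.Iio i, zeroRun r j)

/-- The binomial coefficient of integers, with the convention that it is `0` if `k < 0` or
`n < k`. -/
def intChoose (n k : ℤ) : ℤ := if k < 0 ∨ n < k then 0 else (n.toNat.choose k.toNat : ℤ)

/-- `F(a,b,c,t) = ∑_{j=0}^{a+b} (-1)^j C(a+b, j) C((t+1)(b-j)+a+c-1, a+b-1)`. -/
def F (a b : ℕ) (c : ℤ) (t : ℕ) : ℤ :=
  ∑ j ∈ Finset.range (a + b + 1), (-1) ^ j * intChoose ((a : ℤ) + b) j *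
    intChoose (((t : ℤ) + 1) * ((b : ℤ) - j) + a + c - 1) ((a : ℤ) + b - 1)

/-- The integer vectors `(c_1, …, c_m)` with `-t v_j ≤ c_j ≤ t u_j` and `c_1 + ⋯ + c_j ≥ 0` for
all `j`, and `c_1 + ⋯ + c_m = 0`. -/
noncomputable def admissible {m : ℕ} (r : Fin (2 * m) → ℕ) (t : ℕ) : Finset (Fin m → ℤ) :=
  (Fintype.piFinset fun j => Finset.Icc (-((t : ℤ) * lower r j)) ((t : ℤ) * upper r j)).filter
    fun c => ∑ j, c j = 0 ∧ ∀ j, 0 ≤ ∑ i ∈ Finset.Iic j, c i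

end SchubertEhrhart

/-!
The proof identifies the lattice points of `t • P`, where `P` is the matroid polytope of
`SM_n(S)`, and then counts them one vector `c` at a time.

*Lattice points.* An integer vector `z` lies in `t • P` iff `0 ≤ z i ≤ t`, the total is `t |S|`, and
every prefix sum `Z_k = z_1 + ⋯ + z_k` is at least `t |S ∩ [k]|`. Necessity is clear on the vertices
and passes to the convex hull. For sufficiency, cut `z` into `t` sets: for `0 ≤ s < t` let `B_s`
consist of the positions where `⌊(Z_k + s) / t⌋` jumps. As `z i ≤ t`, each jump is by `1`, so
`|B_s ∩ [k]| = ⌊(Z_k + s) / t⌋ ≥ |S ∩ [k]|` and `B_s` is a basis; by Hermite's identity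
`∑_s ⌊(x + s) / t⌋ = x` the indicator vectors of the `B_s` add up to `z`
(`natCast_mem_smul_matroidPolytope_iff`).

*Reduction to blocks.* Call a run of zeros of `S` together with the following run of ones a block.
Inside a run of zeros `|S ∩ [k]|` is constant, and inside a run of ones it grows as fast as
`Z_k / t` possibly can, so only the prefix inequalities at the ends of blocks matter
(`dominates_iff`). With `c_j` the excess of the `j`-th block sum over `t r_{2j}`, they say that the
prefix sums of `c` are nonnegative. The bounds `-t v_j ≤ c_j ≤ t u_j` are then automatic
(`excess_mem_admissible`).

*Counting.* For fixed `c` the blocks are independent, and the `j`-th one contributes the number of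
vectors in `{0, …, t}^(r_{2j-1} + r_{2j})` with sum `t r_{2j} + c_j`. Expanding
`((1 - X^(t+1)) / (1 - X))^(a+b)` shows that this number is `F` (`card_bounded_sum_eq_F`).
-/

namespace SchubertEhrhart

/-! ### Vectors with bounded entries and given sum -/

open PowerSeries in
/-- The number of vectors in `{0, …, t}^(d+1)` with sum `s`, as a coefficient of
`(1 + X + ⋯ + X^t)^(d+1) = (1 - X^(t+1))^(d+1) (1 - X)^(-(d+1))`. -/
theorem card_bounded_sum_eq {ι : Type*} [Fintype ι] [DecidableEq ι] (t s d : ℕ)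
    (hd : Fintype.card ι = d + 1) :
    (((Fintype.piFinset fun _ : ι => Finset.range (t + 1)).filter
      fun y => ∑ i, y i = s).card : ℤ) =
    ∑ j ∈ Finset.range (d + 2), (-1) ^ j * ((d + 1).choose j : ℤ) *
      if (t + 1) * j ≤ s then ((d + (s - (t + 1) * j)).choose d : ℤ) else 0 := by
  have hcount : (((Fintype.piFinset fun _ : ι => Finset.range (t + 1)).filter
      fun y => ∑ i, y i = s).card : ℤ) =
      coeff s ((∑ x ∈ Finset.range (t + 1), (X : ℤ⟦X⟧) ^ x) ^ (d + 1)) := by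
    have h : (∑ x ∈ Finset.range (t + 1), (X : ℤ⟦X⟧) ^ x) ^ (d + 1) =
        ∑ y ∈ Fintype.piFinset fun _ : ι => Finset.range (t + 1), X ^ ∑ i, y i := by
      simp_rw [← hd, ← Finset.prod_pow_eq_pow_sum]
      rw [← Finset.prod_univ_sum, Finset.prod_const, Finset.card_univ]
    rw [h, map_sum]
    simp_rw [coeff_X_pow]
    rw [Finset.sum_boole]
    simp_rw [eq_comm]
  have hgeom : (∑ x ∈ Finset.range (t + 1), (X : ℤ⟦X⟧) ^ x) ^ (d + 1) =
      (1 - X ^ (t + 1)) ^ (d + 1) * mk fun k => ((d + k).choose d : ℤ) := by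
    rw [← mul_neg_geom_sum, mul_pow, mul_comm ((1 - X) ^ (d + 1)), mul_assoc,
      mul_comm ((1 - X) ^ (d + 1)),
      mk_add_choose_mul_one_sub_pow_eq_one ℤ d, mul_one]
  rw [hcount, hgeom, sub_eq_neg_add, add_pow, Finset.sum_mul, map_sum]
  refine Finset.sum_congr rfl fun j _ => ?_
  have h : (-(X : ℤ⟦X⟧) ^ (t + 1)) ^ j * 1 ^ (d + 1 - j) * ((d + 1).choose j : ℤ⟦X⟧) *
      (mk fun k => ((d + k).choose d : ℤ)) =
      C ((-1) ^ j * ((d + 1).choose j : ℤ)) *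
        (X ^ ((t + 1) * j) * mk fun k => ((d + k).choose d : ℤ)) := by
    rw [neg_pow, one_pow, ← pow_mul]
    simp only [map_mul, map_pow, map_neg, map_one, map_natCast]
    ring
  rw [h, coeff_C_mul, coeff_X_pow_mul']
  simp only [coeff_mk]

/-- `F(a, b, c, t)` counts the vectors in `{0, …, t}^(a+b)` with sum `t b + c`. -/
theorem card_bounded_sum_eq_F {ι : Type*} [Fintype ι] [DecidableEq ι] {a b : ℕ}
    (hb : 0 < b) (hab : Fintype.card ι = a + b) (t : ℕ) (c : ℤ)
    (hc : -((t : ℤ) * b) ≤ c) :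
    (((Fintype.piFinset fun _ : ι => Finset.range (t + 1)).filter
      fun y => ((∑ i, y i : ℕ) : ℤ) = t * b + c).card : ℤ) = F a b c t := by
  obtain ⟨s, hs⟩ := Int.eq_ofNat_of_zero_le (show 0 ≤ (t : ℤ) * b + c by linarith)
  obtain ⟨d, hd⟩ : ∃ d, a + b = d + 1 := ⟨a + b - 1, by omega⟩
  simp only [hs, Nat.cast_inj]
  rw [card_bounded_sum_eq t s d (hab.trans hd), F, hd]
  refine Finset.sum_congr rfl fun j hj => ?_
  have hd' : (a : ℤ) + b = (d : ℤ) + 1 := by exact_mod_cast hd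
  have hj' : j < d + 2 := Finset.mem_range.1 hj
  have h1 : intChoose ((a : ℤ) + b) j = ((d + 1).choose j : ℤ) := by
    rw [intChoose, if_neg (by omega), hd']
    norm_cast
  rw [h1]
  congr 1
  -- The upper entry `p` of `F` is `d + (s - (t + 1) j)`: the convention `C(p, d) = 0` for `p < d`
  -- encodes exactly that the power series coefficient vanishes for `(t + 1) j > s`.
  have hp : ((t : ℤ) + 1) * ((b : ℤ) - j) + a + c - 1 = d + (s - ((t + 1) * j : ℕ)) := by
    push_cast
    rw [← hs]
    linear_combination hd'
  rw [hp, intChoose, show (a : ℤ) + b - 1 = d by omega]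
  split_ifs with h2 h3 h3
  · omega
  · rw [← Nat.cast_sub h2]
    norm_cast
  · rfl
  · omega

/-- Conditions on the sums over the fibers of `β` are independent of each other, so the number of
vectors satisfying them is a product over the fibers. -/
theorem card_filter_fiber_sums {ι κ : Type*} [Fintype ι] [DecidableEq ι] [Fintype κ]
    [DecidableEq κ] (β : ι → κ) (A : Finset ℕ) (p : κ → ℕ → Prop) [∀ j, DecidablePred (p j)] :
    ((Fintype.piFinset fun _ : ι => A).filter
      fun z => ∀ j, p j (∑ i with β i = j, z i)).card =
    ∏ j, ((Fintype.piFinset fun _ : {i // β i = j} => A).filter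
      fun y => p j (∑ i, y i)).card := by
  rw [← Fintype.card_piFinset]
  refine Finset.card_bij' (fun z _ j i => z i) (fun y _ i => y (β i) ⟨i, rfl⟩) ?_ ?_ ?_ ?_
  · intro z hz
    simp only [Finset.mem_filter, Fintype.mem_piFinset] at hz ⊢
    refine fun j => ⟨fun i => hz.1 i, ?_⟩
    rw [← Finset.sum_subtype (Finset.univ.filter fun i => β i = j) (by simp) z]
    exact hz.2 j
  · intro y hy
    simp only [Finset.mem_filter, Fintype.mem_piFinset] at hy ⊢
    refine ⟨fun i => (hy (β i)).1 _, fun j => ?_⟩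
    rw [Finset.sum_subtype (Finset.univ.filter fun i => β i = j) (p := fun i => β i = j) (by simp)]
    have h : ∑ i : {i // β i = j}, y (β i) ⟨i, rfl⟩ = ∑ i, y j i :=
      Finset.sum_congr rfl fun i _ => by obtain ⟨i, rfl⟩ := i; rfl
    rw [h]
    exact (hy j).2
  · intros; rfl
  · intro y _
    funext j i
    obtain ⟨i, rfl⟩ := i
    rfl

/-! ### Prefix sums -/

/-- The sum of the first `k` entries of `z`; for `k ≥ n` this is the sum of all of them. -/
def prefixSum {M : Type*} [AddCommMonoid M] {n : ℕ} (z : Fin n → M) (k : ℕ) : M :=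
  ∑ i with i.val < k, z i

section prefixSum
variable {M : Type*} [AddCommMonoid M] {n : ℕ}

theorem prefixSum_zero (z : Fin n → M) : prefixSum z 0 = 0 := by simp [prefixSum]

theorem prefixSum_succ (z : Fin n → M) (i : Fin n) :
    prefixSum z (i.val + 1) = prefixSum z i.val + z i := by
  have h : (Finset.univ.filter fun j : Fin n => j.val < i.val + 1) =
      insert i (Finset.univ.filter fun j : Fin n => j.val < i.val) := by
    ext j
    simp only [Finset.mem_filter, Finset.mem_univ, true_and, Finset.mem_insert, Fin.ext_iff]
    omega
  rw [prefixSum, h, Finset.sum_insert (by simp), add_comm]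
  rfl

theorem prefixSum_top (z : Fin n → M) : prefixSum z n = ∑ i, z i := by
  simp [prefixSum]

theorem sum_Iio_eq_prefixSum (z : Fin n → M) (i : Fin n) :
    ∑ j ∈ Finset.Iio i, z j = prefixSum z i.val := by
  refine Finset.sum_congr ?_ fun _ _ => rfl
  ext j
  simp

theorem sum_Iic_eq_prefixSum (z : Fin n → M) (i : Fin n) :
    ∑ j ∈ Finset.Iic i, z j = prefixSum z (i.val + 1) := by
  refine Finset.sum_congr ?_ fun _ _ => rfl
  ext j
  simp

theorem prefixSum_natCast {R : Type*} [AddCommMonoidWithOne R] (z : Fin n → ℕ) (k : ℕ) :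
    prefixSum (fun i => (z i : R)) k = (prefixSum z k : ℕ) := by
  simp [prefixSum]

theorem prefixSum_eq_add_block (z : Fin n → M) {p q : ℕ} (hpq : p ≤ q) :
    prefixSum z q = prefixSum z p + ∑ i with p ≤ i.val ∧ i.val < q, z i := by
  have h : (Finset.univ.filter fun i : Fin n => i.val < q) =
      (Finset.univ.filter fun i : Fin n => i.val < p) ∪
        Finset.univ.filter fun i : Fin n => p ≤ i.val ∧ i.val < q := by
    ext i
    simp only [Finset.mem_filter, Finset.mem_univ, true_and, Finset.mem_union]
    omega
  rw [prefixSum, h, Finset.sum_union]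
  · rfl
  · rw [Finset.disjoint_left]
    intro i
    simp only [Finset.mem_filter, Finset.mem_univ, true_and]
    omega

end prefixSum

variable {n : ℕ}

theorem card_filter_val_Ico {p q : ℕ} (hq : q ≤ n) :
    (Finset.univ.filter fun i : Fin n => p ≤ i.val ∧ i.val < q).card = q - p := by
  rw [← Nat.card_Ico p q, ← Finset.card_map Fin.valEmbedding]
  congr 1
  ext i
  simp only [Finset.mem_map, Finset.mem_filter, Finset.mem_univ, true_and, Fin.valEmbedding_apply,
    Finset.mem_Ico]
  constructor
  · rintro ⟨j, hj, rfl⟩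
    exact hj
  · intro h
    exact ⟨⟨i, by omega⟩, h, rfl⟩

theorem prefixSum_mono (z : Fin n → ℕ) : Monotone (prefixSum z) := fun p q h => by
  rw [prefixSum_eq_add_block z h]
  omega

theorem prefixSum_le_add_mul {z : Fin n → ℕ} {t p q : ℕ} (hpq : p ≤ q) (hq : q ≤ n)
    (hz : ∀ i, z i ≤ t) : prefixSum z q ≤ prefixSum z p + (q - p) * t := by
  rw [prefixSum_eq_add_block z hpq, ← card_filter_val_Ico hq]
  exact Nat.add_le_add_left (Finset.sum_le_card_nsmul _ _ _ fun i _ => hz i) _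

theorem prefixSum_eq_add_mul {z : Fin n → ℕ} {c p q : ℕ} (hpq : p ≤ q) (hq : q ≤ n)
    (hz : ∀ i : Fin n, p ≤ i.val → i.val < q → z i = c) :
    prefixSum z q = prefixSum z p + (q - p) * c := by
  rw [prefixSum_eq_add_block z hpq, ← card_filter_val_Ico hq]
  rw [Finset.sum_congr rfl fun i hi =>
    hz i (Finset.mem_filter.1 hi).2.1 (Finset.mem_filter.1 hi).2.2]
  simp

/-! ### Lattice points of the dilated polytope -/

/-- `|S ∩ [k]|`, the number of elements of `S` among the first `k` positions. -/
def rankUpTo (S : Finset (Fin n)) (k : ℕ) : ℕ := (S.filter fun i => i.val < k).card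

theorem rankUpTo_eq_prefixSum (S : Finset (Fin n)) (k : ℕ) :
    rankUpTo S k = prefixSum (fun i => if i ∈ S then 1 else 0) k := by
  rw [prefixSum, Finset.sum_boole, Finset.filter_filter, rankUpTo]
  simp only [Nat.cast_id]
  congr 1
  ext i
  simp [and_comm]

theorem rankUpTo_top (S : Finset (Fin n)) : rankUpTo S n = S.card := by
  simp [rankUpTo]

theorem subsetLE_iff_rankUpTo (T S : Finset (Fin n)) :
    SubsetLE T S ↔ T.card = S.card ∧ ∀ k ≤ n, rankUpTo S k ≤ rankUpTo T k := by
  rw [subsetLE_iff]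
  refine and_congr_right fun h => ⟨fun H k hk => ?_, fun H k => H k k.isLt.le⟩
  rcases hk.lt_or_eq with hk | rfl
  · exact H ⟨k, hk⟩
  · rw [rankUpTo_top, rankUpTo_top, h]

theorem schubertMatroid_isBase_iff (S : Finset (Fin n)) (B : Set (Fin n)) :
    (schubertMatroid S).IsBase B ↔ ∃ T : Finset (Fin n), ↑T = B ∧ SubsetLE T S := Iff.rfl

theorem prefixSum_indicator (T : Finset (Fin n)) (k : ℕ) :
    prefixSum ((T : Set (Fin n)).indicator (1 : Fin n → ℝ)) k = rankUpTo T k := by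
  rw [rankUpTo_eq_prefixSum, ← prefixSum_natCast]
  congr 1
  funext i
  simp [Set.indicator_apply]

theorem mem_matroidPolytope_bounds {S : Finset (Fin n)} {x : Fin n → ℝ}
    (hx : x ∈ matroidPolytope (schubertMatroid S)) :
    (∀ i, 0 ≤ x i ∧ x i ≤ 1) ∧ (∀ k ≤ n, (rankUpTo S k : ℝ) ≤ prefixSum x k) ∧
      prefixSum x n = S.card := by
  have hlin : ∀ (k : ℕ) (a b : ℝ) (x y : Fin n → ℝ),
      prefixSum (a • x + b • y) k = a * prefixSum x k + b * prefixSum y k := by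
    intro k a b x y
    simp [prefixSum, Finset.sum_add_distrib, Finset.mul_sum]
  let Q : Set (Fin n → ℝ) := {x | (∀ i, 0 ≤ x i ∧ x i ≤ 1) ∧
    (∀ k ≤ n, (rankUpTo S k : ℝ) ≤ prefixSum x k) ∧ prefixSum x n = S.card}
  have hQ : Convex ℝ Q := by
    intro x hx y hy a b ha hb hab
    refine ⟨fun i => ?_, fun k hk => ?_, ?_⟩
    · have h1 := hx.1 i
      have h2 := hy.1 i
      simp only [Pi.add_apply, Pi.smul_apply, smul_eq_mul]
      constructor
      · exact add_nonneg (mul_nonneg ha h1.1) (mul_nonneg hb h2.1)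
      · nlinarith [mul_le_mul_of_nonneg_left h1.2 ha, mul_le_mul_of_nonneg_left h2.2 hb]
    · rw [hlin]
      have h1 := mul_le_mul_of_nonneg_left (hx.2.1 k hk) ha
      have h2 := mul_le_mul_of_nonneg_left (hy.2.1 k hk) hb
      calc (rankUpTo S k : ℝ) = a * rankUpTo S k + b * rankUpTo S k := by
            rw [← add_mul, hab, one_mul]
        _ ≤ _ := add_le_add h1 h2
    · rw [hlin, hx.2.2, hy.2.2, ← add_mul, hab, one_mul]
  refine convexHull_min (t := Q) ?_ hQ hx
  rintro _ ⟨B, hB, rfl⟩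
  obtain ⟨T, rfl, hT⟩ := (schubertMatroid_isBase_iff S B).1 hB
  rw [subsetLE_iff_rankUpTo] at hT
  refine ⟨fun i => ?_, fun k hk => ?_, ?_⟩
  · by_cases h : i ∈ T <;> simp [h]
  · rw [prefixSum_indicator]
    exact_mod_cast hT.2 k hk
  · rw [prefixSum_indicator, rankUpTo_top, hT.1]

/-- Hermite's identity, for `x / t`. -/
theorem sum_range_add_div (t x : ℕ) (ht : 0 < t) : ∑ s ∈ Finset.range t, (x + s) / t = x := by
  induction x with
  | zero =>
    refine Finset.sum_eq_zero fun s hs => ?_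
    rw [zero_add, Nat.div_eq_of_lt (Finset.mem_range.1 hs)]
  | succ x ih =>
    have h1 := Finset.sum_range_succ (fun s => (x + s) / t) t
    have h2 := Finset.sum_range_succ' (fun s => (x + s) / t) t
    rw [ih, Nat.add_div_right x ht] at h1
    have h3 : ∑ s ∈ Finset.range t, (x + 1 + s) / t = ∑ s ∈ Finset.range t, (x + (s + 1)) / t :=
      Finset.sum_congr rfl fun s _ => by rw [add_assoc, add_comm 1 s]
    rw [add_zero] at h2
    omega

/-- The `s`-th of `t` sets into which a vector `z` with entries at most `t` is cut: the positions
where `k ↦ ⌊(z_1 + ⋯ + z_k + s) / t⌋` jumps. -/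
def slice (z : Fin n → ℕ) (t s : ℕ) : Finset (Fin n) :=
  Finset.univ.filter fun i =>
    (prefixSum z i.val + s) / t < (prefixSum z (i.val + 1) + s) / t

theorem slice_step {z : Fin n → ℕ} {t : ℕ} (ht : 0 < t) (hz : ∀ i, z i ≤ t) (s : ℕ) (i : Fin n) :
    (prefixSum z (i.val + 1) + s) / t =
      (prefixSum z i.val + s) / t + if i ∈ slice z t s then 1 else 0 := by
  have h1 : (prefixSum z (i.val + 1) + s) / t ≤ (prefixSum z i.val + s) / t + 1 := by
    rw [← Nat.add_div_right _ ht]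
    apply Nat.div_le_div_right
    have := hz i
    rw [prefixSum_succ]
    omega
  have h2 : (prefixSum z i.val + s) / t ≤ (prefixSum z (i.val + 1) + s) / t :=
    Nat.div_le_div_right (Nat.add_le_add_right (prefixSum_mono z (Nat.le_succ _)) s)
  split_ifs with h <;>
    simp only [slice, Finset.mem_filter, Finset.mem_univ, true_and] at h <;>
    omega

theorem rankUpTo_slice {z : Fin n → ℕ} {t s : ℕ} (hs : s < t) (hz : ∀ i, z i ≤ t) {k : ℕ}
    (hk : k ≤ n) : rankUpTo (slice z t s) k = (prefixSum z k + s) / t := by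
  rw [rankUpTo_eq_prefixSum]
  induction k with
  | zero => rw [prefixSum_zero, prefixSum_zero, zero_add, Nat.div_eq_of_lt hs]
  | succ k ih =>
    rw [slice_step (by omega) hz s ⟨k, hk⟩, ← ih (by omega)]
    exact prefixSum_succ _ ⟨k, hk⟩

theorem slice_subsetLE {S : Finset (Fin n)} {z : Fin n → ℕ} {t s : ℕ} (hs : s < t)
    (hz : ∀ i, z i ≤ t) (hS : ∀ k ≤ n, t * rankUpTo S k ≤ prefixSum z k)
    (htot : prefixSum z n = t * S.card) : SubsetLE (slice z t s) S := by
  rw [subsetLE_iff_rankUpTo]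
  refine ⟨?_, fun k hk => ?_⟩
  · rw [← rankUpTo_top, rankUpTo_slice hs hz le_rfl, htot, Nat.mul_add_div (by omega),
      Nat.div_eq_of_lt hs, add_zero]
  · rw [rankUpTo_slice hs hz hk, Nat.le_div_iff_mul_le (by omega), mul_comm]
    exact (hS k hk).trans (Nat.le_add_right _ _)

theorem sum_slice {z : Fin n → ℕ} {t : ℕ} (ht : 0 < t) (hz : ∀ i, z i ≤ t) (i : Fin n) :
    ∑ s ∈ Finset.range t, (if i ∈ slice z t s then 1 else 0) = z i := by
  have h := Finset.sum_congr (rfl : Finset.range t = _) fun s _ => slice_step ht hz s i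
  rw [Finset.sum_add_distrib, sum_range_add_div t _ ht, sum_range_add_div t _ ht,
    prefixSum_succ] at h
  omega

open scoped Pointwise in
/-- The lattice points of the dilated polytope are the integer vectors satisfying its defining
inequalities; they are sums of `t` indicator vectors of bases, namely of the slices. -/
theorem natCast_mem_smul_matroidPolytope_iff {S : Finset (Fin n)} {t : ℕ} (ht : 0 < t)
    (z : Fin n → ℤ) :
    (fun i => (z i : ℝ)) ∈ (t : ℝ) • matroidPolytope (schubertMatroid S) ↔
      ∃ y : Fin n → ℕ, (∀ i, (y i : ℤ) = z i) ∧ (∀ i, y i ≤ t) ∧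
        (∀ k ≤ n, t * rankUpTo S k ≤ prefixSum y k) ∧ prefixSum y n = t * S.card := by
  have ht' : (0 : ℝ) < t := by exact_mod_cast ht
  constructor
  · rintro ⟨x, hx, hxz⟩
    obtain ⟨h1, h2, h3⟩ := mem_matroidPolytope_bounds hx
    have hxz' : ∀ i, (z i : ℝ) = t * x i := fun i => (congrFun hxz i).symm
    have hz0 : ∀ i, 0 ≤ z i := fun i => by
      have : (0 : ℝ) ≤ z i := by rw [hxz']; exact mul_nonneg ht'.le (h1 i).1
      exact_mod_cast this
    have hy : ∀ i, (((z i).toNat : ℕ) : ℤ) = z i := fun i => Int.toNat_of_nonneg (hz0 i)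
    have hyx : ∀ i, (((z i).toNat : ℕ) : ℝ) = t * x i := fun i => by
      rw [← hxz']; exact_mod_cast hy i
    have hpre : ∀ k, ((prefixSum (fun i => (z i).toNat) k : ℕ) : ℝ) = t * prefixSum x k := by
      intro k
      rw [← prefixSum_natCast]
      simp only [hyx]
      simp [prefixSum, Finset.mul_sum]
    refine ⟨fun i => (z i).toNat, hy, fun i => ?_, fun k hk => ?_, ?_⟩
    · have : (((z i).toNat : ℕ) : ℝ) ≤ t := by
        rw [hyx]
        exact mul_le_of_le_one_right ht'.le (h1 i).2
      exact_mod_cast this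
    · have : ((t * rankUpTo S k : ℕ) : ℝ) ≤ (prefixSum (fun i => (z i).toNat) k : ℕ) := by
        rw [hpre, Nat.cast_mul]
        exact mul_le_mul_of_nonneg_left (h2 k hk) ht'.le
      exact_mod_cast this
    · have : ((prefixSum (fun i => (z i).toNat) n : ℕ) : ℝ) = (t * S.card : ℕ) := by
        rw [hpre, h3, Nat.cast_mul]
      exact_mod_cast this
  · rintro ⟨y, hyz, hy, hS, htot⟩
    refine ⟨∑ s ∈ Finset.range t, (t : ℝ)⁻¹ • (slice y t s : Set (Fin n)).indicator 1, ?_, ?_⟩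
    · refine (convex_convexHull ℝ _).sum_mem (fun _ _ => by positivity) ?_ fun s hs => ?_
      · simp [ht'.ne']
      · exact subset_convexHull ℝ _ ⟨_, (schubertMatroid_isBase_iff S _).2
          ⟨_, rfl, slice_subsetLE (Finset.mem_range.1 hs) hy hS htot⟩, rfl⟩
    · funext i
      have h := congrArg (Nat.cast : ℕ → ℝ) (sum_slice ht hy i)
      have hz : (z i : ℝ) = (y i : ℝ) := by exact_mod_cast (hyz i).symm
      simp only [Pi.smul_apply, Finset.sum_apply, smul_eq_mul, hz, ← h, Finset.mul_sum]
      push_cast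
      refine Finset.sum_congr rfl fun s _ => ?_
      rw [mul_inv_cancel_left₀ ht'.ne']
      simp [Set.indicator_apply]

/-- The lattice points of `t • P`, where `P` is the polytope of `SM_n(S)`, with coordinates in `ℕ`:
bounds on the entries, prefix inequalities and total. -/
def dilatePoints (S : Finset (Fin n)) (t : ℕ) : Finset (Fin n → ℕ) :=
  (Fintype.piFinset fun _ => Finset.range (t + 1)).filter fun y =>
    (∀ k ≤ n, t * rankUpTo S k ≤ prefixSum y k) ∧ prefixSum y n = t * S.card

theorem latticePointCount_schubertMatroid (S : Finset (Fin n)) {t : ℕ} (ht : 0 < t) :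
    latticePointCount (matroidPolytope (schubertMatroid S)) t = (dilatePoints S t).card := by
  have hinj : Function.Injective fun (y : Fin n → ℕ) (i : Fin n) => (y i : ℤ) :=
    fun y y' h => funext fun i => Int.ofNat_inj.1 (congrFun h i)
  rw [latticePointCount, ← Set.ncard_coe_finset, ← Set.ncard_image_of_injective _ hinj]
  congr 1
  ext z
  simp only [Set.mem_ofPred_eq, Set.mem_image, natCast_mem_smul_matroidPolytope_iff ht,
    dilatePoints, Finset.coe_filter, Fintype.mem_piFinset, Finset.mem_range, Nat.lt_succ_iff]
  constructor
  · rintro ⟨y, h1, h2, h3⟩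
    exact ⟨y, ⟨h2, h3⟩, funext h1⟩
  · rintro ⟨y, ⟨h2, h3⟩, rfl⟩
    exact ⟨y, fun _ => rfl, h2, h3⟩

/-! ### Blocks of runs -/

variable {m : ℕ}

/-- The number of positions before the `j`-th block (`j = 0, …, m - 1`), which consists of the runs
with indices `2j` and `2j + 1`. Accordingly `blockStart r m` is the total length. -/
def blockStart (r : Fin (2 * m) → ℕ) (j : ℕ) : ℕ := prefixSum r (2 * j)

theorem prefixSum_run_mid (r : Fin (2 * m) → ℕ) (j : Fin m) :
    prefixSum r (2 * j.val + 1) = blockStart r j + zeroRun r j :=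
  prefixSum_succ r ⟨2 * j.val, by omega⟩

theorem blockStart_succ (r : Fin (2 * m) → ℕ) (j : Fin m) :
    blockStart r (j.val + 1) = blockStart r j + zeroRun r j + oneRun r j := by
  rw [← prefixSum_run_mid]
  exact prefixSum_succ r ⟨2 * j.val + 1, by omega⟩

theorem blockStart_mono (r : Fin (2 * m) → ℕ) : Monotone (blockStart r) :=
  fun _ _ h => prefixSum_mono r (by omega)

theorem blockStart_eq_prefixSum (r : Fin (2 * m) → ℕ) {j : ℕ} (hj : j ≤ m) :
    blockStart r j = prefixSum (zeroRun r) j + prefixSum (oneRun r) j := by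
  induction j with
  | zero => simp [blockStart, prefixSum_zero]
  | succ j ih =>
    have h1 := prefixSum_succ (zeroRun r) ⟨j, hj⟩
    have h2 := prefixSum_succ (oneRun r) ⟨j, hj⟩
    have h3 := blockStart_succ r ⟨j, hj⟩
    have h4 := ih (by omega)
    dsimp only at h1 h2 h3
    omega

theorem exists_block (r : Fin (2 * m) → ℕ) {k : ℕ} (hk : k < blockStart r m) :
    ∃ j : Fin m, blockStart r j ≤ k ∧ k < blockStart r (j.val + 1) := by
  have h : ∀ l ≤ m, k < blockStart r l →
      ∃ j : Fin m, blockStart r j ≤ k ∧ k < blockStart r (j.val + 1) := by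
    intro l
    induction l with
    | zero => intro _ h; simp [blockStart, prefixSum_zero] at h
    | succ l ih =>
      intro hl h
      by_cases hlk : k < blockStart r l
      · exact ih (by omega) hlk
      · exact ⟨⟨l, hl⟩, by simpa using hlk, h⟩
  exact h m le_rfl hk

theorem block_unique (r : Fin (2 * m) → ℕ) {k : ℕ} {i j : Fin m}
    (hi : blockStart r i ≤ k ∧ k < blockStart r (i.val + 1))
    (hj : blockStart r j ≤ k ∧ k < blockStart r (j.val + 1)) : i = j := by
  rcases lt_trichotomy i j with h | h | h
  · have := blockStart_mono r (show i.val + 1 ≤ j.val from h)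
    omega
  · exact h
  · have := blockStart_mono r (show j.val + 1 ≤ i.val from h)
    omega

/-! ### The vector of block excesses -/

/-- The sum of `y` over the `j`-th block minus `t` times the number of ones in that block. -/
def excess (r : Fin (2 * m) → ℕ) (t : ℕ) (y : Fin n → ℕ) (j : Fin m) : ℤ :=
  ((prefixSum y (blockStart r (j.val + 1)) : ℕ) : ℤ) - prefixSum y (blockStart r j) - t * oneRun r j

/-- The prefix conditions of `admissible`, with the trivial one for the empty prefix added. -/
theorem mem_admissible_iff {t : ℕ} {c : Fin m → ℤ} {r : Fin (2 * m) → ℕ} :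
    c ∈ admissible r t ↔ (∀ j, -((t : ℤ) * lower r j) ≤ c j ∧ c j ≤ t * upper r j) ∧
      (∀ j ≤ m, 0 ≤ prefixSum c j) ∧ prefixSum c m = 0 := by
  simp only [admissible, Finset.mem_filter, Fintype.mem_piFinset, Finset.mem_Icc, prefixSum_top,
    sum_Iic_eq_prefixSum]
  refine and_congr_right fun _ => ?_
  rw [and_comm]
  refine and_congr_left fun _ => ⟨fun h j hj => ?_, fun h j => h _ j.isLt⟩
  cases j with
  | zero => rw [prefixSum_zero]
  | succ j => exact h ⟨j, hj⟩

section encoding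
variable {S : Finset (Fin n)} {r : Fin (2 * m) → ℕ} (hr : IsRunEncoding S r)
include hr

theorem IsRunEncoding.blockStart_top : blockStart r m = n := by
  rw [blockStart, prefixSum_top, hr.total]

theorem IsRunEncoding.blockStart_le {j : ℕ} (hj : j ≤ m) : blockStart r j ≤ n :=
  (blockStart_mono r hj).trans_eq hr.blockStart_top

theorem IsRunEncoding.mem_iff (i : Fin (2 * m)) (k : Fin n) (h1 : prefixSum r i.val ≤ k.val)
    (h2 : k.val < prefixSum r (i.val + 1)) : k ∈ S ↔ Odd i.val :=
  hr.indicator i k (by rwa [sum_Iio_eq_prefixSum]) (by rwa [sum_Iic_eq_prefixSum])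

theorem IsRunEncoding.rankUpTo_zeroRun (j : Fin m) {k : ℕ} (h1 : blockStart r j ≤ k)
    (h2 : k ≤ blockStart r j + zeroRun r j) : rankUpTo S k = rankUpTo S (blockStart r j) := by
  have h3 := blockStart_succ r j
  have h4 := hr.blockStart_le (j := j.val + 1) j.isLt
  rw [rankUpTo_eq_prefixSum, rankUpTo_eq_prefixSum,
    prefixSum_eq_add_mul (c := 0) h1 (by omega), mul_zero, add_zero]
  intro i hi1 hi2
  rw [if_neg]
  rw [hr.mem_iff ⟨2 * j.val, by omega⟩ i hi1 (by rw [prefixSum_run_mid]; omega)]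
  simp

theorem IsRunEncoding.rankUpTo_oneRun (j : Fin m) {k : ℕ}
    (h1 : blockStart r j + zeroRun r j ≤ k) (h2 : k ≤ blockStart r (j.val + 1)) :
    rankUpTo S k = rankUpTo S (blockStart r j) + (k - (blockStart r j + zeroRun r j)) := by
  have h4 := hr.blockStart_le (j := j.val + 1) j.isLt
  rw [← hr.rankUpTo_zeroRun j (Nat.le_add_right _ _) le_rfl, rankUpTo_eq_prefixSum,
    rankUpTo_eq_prefixSum, prefixSum_eq_add_mul (c := 1) h1 (by omega), mul_one]
  intro i hi1 hi2
  rw [if_pos]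
  rw [hr.mem_iff ⟨2 * j.val + 1, by omega⟩ i (by rwa [prefixSum_run_mid]) (by
    change _ < blockStart r (j.val + 1)
    omega)]
  simp

theorem IsRunEncoding.rankUpTo_blockStart {j : ℕ} (hj : j ≤ m) :
    rankUpTo S (blockStart r j) = prefixSum (oneRun r) j := by
  induction j with
  | zero => simp [blockStart, prefixSum_zero, rankUpTo]
  | succ j ih =>
    have h1 := prefixSum_succ (oneRun r) ⟨j, hj⟩
    have h2 := blockStart_succ r ⟨j, hj⟩
    have h3 := hr.rankUpTo_oneRun ⟨j, hj⟩ (k := blockStart r (j + 1)) (by dsimp only at *; omega)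
      le_rfl
    have h4 := ih (by omega)
    dsimp only at *
    omega

/-- The prefix inequalities need to be checked at the ends of blocks only. -/
theorem IsRunEncoding.dominates_iff {y : Fin n → ℕ} {t : ℕ} (hy : ∀ i, y i ≤ t) :
    (∀ k ≤ n, t * rankUpTo S k ≤ prefixSum y k) ↔
      ∀ j ≤ m, t * rankUpTo S (blockStart r j) ≤ prefixSum y (blockStart r j) := by
  refine ⟨fun h j hj => h _ (hr.blockStart_le hj), fun h k hk => ?_⟩
  rcases hk.eq_or_lt with rfl | hk
  · simpa only [hr.blockStart_top] using h m le_rfl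
  obtain ⟨j, hj1, hj2⟩ := exists_block r (hk.trans_eq hr.blockStart_top.symm)
  rcases le_total k (blockStart r j + zeroRun r j) with hkj | hkj
  · rw [hr.rankUpTo_zeroRun j hj1 hkj]
    exact (h j j.isLt.le).trans (prefixSum_mono y hj1)
  · have h1 := h (j.val + 1) j.isLt
    have h2 := prefixSum_le_add_mul hj2.le (hr.blockStart_le (j := j.val + 1) j.isLt) hy
    have h3 := hr.rankUpTo_oneRun j (hkj.trans hj2.le) le_rfl
    have h4 := hr.rankUpTo_oneRun j hkj hj2.le
    have h5 : rankUpTo S (blockStart r (j.val + 1)) =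
        rankUpTo S k + (blockStart r (j.val + 1) - k) := by omega
    rw [h5, mul_add, mul_comm t (_ - k)] at h1
    omega

/-- The prefix sums of the excesses telescope to the slack in the prefix inequalities. -/
theorem IsRunEncoding.prefixSum_excess (t : ℕ) (y : Fin n → ℕ) {j : ℕ} (hj : j ≤ m) :
    prefixSum (excess r t y) j =
      ((prefixSum y (blockStart r j) : ℕ) : ℤ) - t * rankUpTo S (blockStart r j) := by
  rw [hr.rankUpTo_blockStart hj]
  induction j with
  | zero => simp [blockStart, prefixSum_zero]
  | succ j ih =>
    have h1 := prefixSum_succ (excess r t y) ⟨j, hj⟩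
    have h2 := prefixSum_succ (oneRun r) ⟨j, hj⟩
    dsimp only at h1 h2
    rw [h1, ih (by omega), h2, excess]
    push_cast
    ring

theorem IsRunEncoding.mem_dilatePoints_iff {t : ℕ} {y : Fin n → ℕ} :
    y ∈ dilatePoints S t ↔ (∀ i, y i ≤ t) ∧ (∀ j ≤ m, 0 ≤ prefixSum (excess r t y) j) ∧
      prefixSum (excess r t y) m = 0 := by
  simp only [dilatePoints, Finset.mem_filter, Fintype.mem_piFinset, Finset.mem_range,
    Nat.lt_succ_iff]
  refine and_congr_right fun hy => and_congr ?_ ?_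
  · rw [hr.dominates_iff hy]
    refine forall₂_congr fun j hj => ?_
    rw [hr.prefixSum_excess t y hj, sub_nonneg]
    norm_cast
  · rw [hr.prefixSum_excess t y le_rfl, hr.blockStart_top, rankUpTo_top, sub_eq_zero]
    norm_cast

/-- The bounds in terms of `lower` and `upper` follow from the prefix inequalities: the slack before
a block is at most `t` times the number of preceding zeros, and the slack after it is at most `t`
times the number of subsequent ones. -/
theorem IsRunEncoding.excess_mem_admissible {t : ℕ} {y : Fin n → ℕ} (hy : y ∈ dilatePoints S t) :
    excess r t y ∈ admissible r t := by
  obtain ⟨hyt, hpos, htot⟩ := hr.mem_dilatePoints_iff.1 hy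
  refine mem_admissible_iff.2 ⟨fun j => ?_, hpos, htot⟩
  have hsucc := blockStart_succ r j
  have hle := hr.blockStart_le (j := j.val + 1) j.isLt
  have hle' := hr.blockStart_le j.isLt.le
  have hmono : blockStart r j ≤ blockStart r (j.val + 1) := blockStart_mono r (Nat.le_succ _)
  have hD := prefixSum_succ (excess r t y) j
  have hex : excess r t y j = ((prefixSum y (blockStart r (j.val + 1)) : ℕ) : ℤ) -
    prefixSum y (blockStart r j) - t * oneRun r j := rfl
  have hm1 : ((prefixSum y (blockStart r j) : ℕ) : ℤ) ≤ prefixSum y (blockStart r (j.val + 1)) := by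
    exact_mod_cast prefixSum_mono y hmono
  have h0 := hpos j j.isLt.le
  have h1 := hpos (j.val + 1) j.isLt
  constructor
  · rw [lower, Nat.cast_min, mul_min_of_nonneg _ _ (by positivity), neg_le, le_min_iff]
    constructor
    · linarith
    · rw [sum_Iio_eq_prefixSum]
      have h2 := hr.prefixSum_excess t y j.isLt.le
      have h3 := prefixSum_le_add_mul (Nat.zero_le _) hle' hyt
      rw [prefixSum_zero, zero_add, Nat.sub_zero] at h3
      have h4 : (blockStart r j : ℤ) =
          prefixSum (zeroRun r) j.val + prefixSum (oneRun r) j.val := by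
        exact_mod_cast blockStart_eq_prefixSum r j.isLt.le
      have h3' : ((prefixSum y (blockStart r j) : ℕ) : ℤ) ≤ blockStart r j * t := by
        exact_mod_cast h3
      rw [hr.rankUpTo_blockStart j.isLt.le] at h2
      rw [h4] at h3'
      linarith
  · rw [upper, Nat.cast_min, mul_min_of_nonneg _ _ (by positivity), le_min_iff]
    constructor
    · have h2 := prefixSum_le_add_mul hmono hle hyt
      rw [hsucc, add_assoc, Nat.add_sub_cancel_left, ← add_assoc, ← hsucc] at h2
      have h2' : ((prefixSum y (blockStart r (j.val + 1)) : ℕ) : ℤ) ≤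
          prefixSum y (blockStart r j) + (zeroRun r j + oneRun r j) * t := by exact_mod_cast h2
      linarith
    · have h2 := hr.prefixSum_excess t y (j := j.val + 1) j.isLt
      have h3 := hr.prefixSum_excess t y le_rfl
      rw [htot, hr.rankUpTo_blockStart le_rfl] at h3
      rw [hr.rankUpTo_blockStart (j := j.val + 1) j.isLt] at h2
      have h4 : ((prefixSum y (blockStart r (j.val + 1)) : ℕ) : ℤ) ≤
          prefixSum y (blockStart r m) := by
        exact_mod_cast prefixSum_mono y (blockStart_mono r (show j.val + 1 ≤ m from j.isLt))
      have h5 : prefixSum (oneRun r) (j.val + 1) + ∑ i ∈ Finset.Ioi j, oneRun r i =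
          prefixSum (oneRun r) m := by
        rw [← sum_Iic_eq_prefixSum, prefixSum_top, ← Finset.sum_union]
        · congr 1
          ext i
          simp [le_or_gt]
        · rw [Finset.disjoint_left]
          intro i h h'
          exact absurd (Finset.mem_Iic.1 h) (not_le.2 (Finset.mem_Ioi.1 h'))
      have h5' : ((prefixSum (oneRun r) (j.val + 1) : ℕ) : ℤ) +
          (∑ i ∈ Finset.Ioi j, oneRun r i : ℕ) =
          (prefixSum (oneRun r) m : ℕ) := by exact_mod_cast h5
      have h6 : (t : ℤ) * (∑ i ∈ Finset.Ioi j, oneRun r i : ℕ) =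
          t * (prefixSum (oneRun r) m : ℕ) - t * (prefixSum (oneRun r) (j.val + 1) : ℕ) := by
        rw [← h5']; ring
      rw [h6]
      linarith

/-- The lattice points with given excesses `c` are the vectors in `{0, …, t}^n` with prescribed
block sums, because admissibility of `c` already yields the prefix inequalities. -/
theorem IsRunEncoding.card_fiber_excess {t : ℕ} {c : Fin m → ℤ} (hc : c ∈ admissible r t) :
    (((dilatePoints S t).filter fun y => excess r t y = c).card : ℤ) =
      ∏ j, F (zeroRun r j) (oneRun r j) (c j) t := by
  obtain ⟨hb, hpos, htot⟩ := mem_admissible_iff.1 hc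
  choose β hβ using fun k : Fin n => exists_block r (k.isLt.trans_eq hr.blockStart_top.symm)
  have hβ' : ∀ j, (Finset.univ.filter fun k => β k = j) = Finset.univ.filter fun k : Fin n =>
      blockStart r j ≤ k.val ∧ k.val < blockStart r (j.val + 1) := by
    intro j
    ext k
    simp only [Finset.mem_filter, Finset.mem_univ, true_and]
    exact ⟨fun h => h ▸ hβ k, fun h => block_unique r (hβ k) h⟩
  have hex : ∀ y : Fin n → ℕ, excess r t y = c ↔
      ∀ j, ((∑ k with β k = j, y k : ℕ) : ℤ) = t * oneRun r j + c j := by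
    intro y
    rw [funext_iff]
    refine forall_congr' fun j => ?_
    have h := prefixSum_eq_add_block y (blockStart_mono r (Nat.le_succ j.val))
    rw [← hβ' j] at h
    rw [excess, h]
    push_cast
    constructor <;> intro h <;> linarith
  have hcard := card_filter_fiber_sums β (Finset.range (t + 1))
    fun j s => (s : ℤ) = t * oneRun r j + c j
  have hset : ((dilatePoints S t).filter fun y => excess r t y = c).card = _ :=
    Eq.trans (congrArg Finset.card (Finset.ext fun y => by
      simp only [Finset.mem_filter, ← hex, hr.mem_dilatePoints_iff, Fintype.mem_piFinset,
        Finset.mem_range, Nat.lt_succ_iff]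
      constructor
      · rintro ⟨⟨h, -⟩, h'⟩
        exact ⟨h, h'⟩
      · rintro ⟨h, rfl⟩
        exact ⟨⟨h, hpos, htot⟩, rfl⟩)) hcard
  rw [hset, Nat.cast_prod]
  refine Finset.prod_congr rfl fun j _ => card_bounded_sum_eq_F ?_ ?_ t (c j) ?_
  · exact hr.pos ⟨2 * j.val + 1, by omega⟩ (Nat.succ_pos _)
  · rw [Fintype.card_subtype, hβ', card_filter_val_Ico (hr.blockStart_le (j := j.val + 1) j.isLt),
      blockStart_succ]
    omega
  · refine le_trans ?_ (hb j).1
    exact neg_le_neg (mul_le_mul_of_nonneg_left (by exact_mod_cast min_le_left _ _)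
      (by positivity))

end encoding

end SchubertEhrhart

theorem theorem1p1 {n m : ℕ} (S : Finset (Fin n)) (r : Fin (2 * m) → ℕ)
    (hr : SchubertEhrhart.IsRunEncoding S r) (t : ℕ) (ht : 0 < t) :
    (SchubertEhrhart.latticePointCount
        (SchubertEhrhart.matroidPolytope (SchubertEhrhart.schubertMatroid S)) t : ℤ) =
      ∑ c ∈ SchubertEhrhart.admissible r t,
        ∏ j : Fin m,
          SchubertEhrhart.F (SchubertEhrhart.zeroRun r j) (SchubertEhrhart.oneRun r j) (c j) t := by
  rw [SchubertEhrhart.latticePointCount_schubertMatroid S ht,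
    Finset.card_eq_sum_card_fiberwise fun y hy => hr.excess_mem_admissible hy, Nat.cast_sum]
  exact Finset.sum_congr rfl fun c hc => hr.card_fiber_excess hc
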